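/- Let $G$ be a finitely generated group that splits non-trivially over a finite subgroup $A$; that is, either $G = H_1 *_A H_2$ is an amalgamated free product of two subgroups $H_1, H_2$ in both of which $A$ is a proper subgroup, or $G$ is an HNN extension $\langle H_1, t \mid t^{-1}at=\varphi(a)\ (a\in A)\rangle$ of a subgroup $H_1 \ge A$ along an isomorphism $\varphi\colon A\to B$ onto a subgroup $B$ of $H_1$. Let $H$ be an infinite vertex group of this splitting ($H=H_1$ or $H=H_2$ in the first case, $H=H_1$ in the second). Then $G$ has a largest finite normal subgroup $X$, it is contained in $H$, and $G$ has a subgroup isomorphic to the HNN extension $\langle H, t\mid t^{-1}xt=x\ (x\in X)\rangle$ of $H$ along the identity map $1_X\colon X\to X$. -/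

import Mathlib

/-- `G` is the (internal) amalgamated free product `K true ∗_A K false` of two of its subgroups
over a common subgroup `A`, and this decomposition is non-trivial: `A` is a proper subgroup of both
factors. The isomorphism from the amalgamated product to `G` is the canonical one: it extends the
inclusions of the two factors. -/
def IsNontrivialAmalgam {G : Type*} [Group G] (A : Subgroup G) (K : Bool → Subgroup G) : Prop :=
  (∀ i, A ≠ K i) ∧
    ∃ (hAK : ∀ i, A ≤ K i)
      (f : Monoid.PushoutI (fun i => Subgroup.inclusion (hAK i)) ≃* G),
      ∀ (i : Bool) (k : K i),
        f (Monoid.PushoutI.of (φ := fun i => Subgroup.inclusion (hAK i)) i k) = (k : G)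

/-- `G` is the (internal) HNN extension of its subgroup `H` along an isomorphism `φ` of the
subgroup `A` of `H` onto some subgroup `B` of `H`. The isomorphism from the HNN extension to `G`
extends the inclusion of `H`. (The stable letter `t` of `HNNExtension` satisfies
`t * a * t⁻¹ = φ a`; its inverse satisfies `t⁻¹ * a * t = φ a`.) Such a decomposition is always
non-trivial. -/
def IsHNNDecomposition {G : Type*} [Group G] (A H : Subgroup G) : Prop :=
  A ≤ H ∧
    ∃ (B : Subgroup H) (φ : A.subgroupOf H ≃* B)
      (f : HNNExtension H (A.subgroupOf H) B φ ≃* G),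
      ∀ h : H, f (HNNExtension.of h) = (h : G)

/-- `G` splits non-trivially over its subgroup `A`, as an amalgamated free product or as an HNN
extension, and `H` is a vertex group of the splitting: one of the two factors of the amalgamated
product, or the base group of the HNN extension. -/
def SplitsNontriviallyOver {G : Type*} [Group G] (A H : Subgroup G) : Prop :=
  (∃ K : Bool → Subgroup G, IsNontrivialAmalgam A K ∧ ∃ i, H = K i) ∨ IsHNNDecomposition A H

/-- `X` is the largest finite normal subgroup of `G`: it is finite and normal, and it contains every
finite normal subgroup of `G`. -/
def IsLargestFiniteNormal {G : Type*} [Group G] (X : Subgroup G) : Prop :=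
  IsGreatest {N : Subgroup G | N.Normal ∧ Finite N} X

/-! Normal forms enter only through one common abstraction: a set S of words that begin and end
outside H, where s * w * s' is reduced whenever w in H avoids a finite set E. Every element outside
H lies in HSH. For amalgams E = A, for HNN extensions E = A ∪ B.

Since s * h * s⁻¹ lies in S unless h ∈ E, H meets each of its conjugates by S in a finite set. As H
is infinite, finitely many bad w can always be avoided. Hence the normal core X of H is finite and
contains every finite normal subgroup. A conjugate meeting H in as few elements as possible meets it
inside X (`exists_conj_mem_normalCore`).

The embedding sends the base to a conjugate of H in which every element outside X becomes a long
word, and the stable letter to a long word centralizing X. Reduced words of the HNN extension then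
map to free concatenations, so none becomes trivial (`injective_of_concatenation`). -/

/-- A set `S` of elements outside the subgroup `H`, to be thought of as those with a reduced word
that starts and ends outside `H`: elements of `S` can be concatenated through any element of `H`
that avoids the finite set `E`, and `S` meets every double coset of `H` other than `H` itself. -/
structure IsFreeConcatenation {G : Type*} [Group G] (H : Subgroup G) (E S : Set G) : Prop where
  finite : E.Finite
  nonempty : S.Nonempty
  inv_mem : ∀ s ∈ S, s⁻¹ ∈ S
  mul_mem : ∀ s ∈ S, ∀ w ∈ H, w ∉ E → ∀ s' ∈ S, s * w * s' ∈ S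
  notMem : ∀ s ∈ S, s ∉ H
  exists_eq : ∀ g ∉ H, ∃ a ∈ H, ∃ s ∈ S, ∃ b ∈ H, g = a * s * b

/-! ### Intersections of conjugates and the largest finite normal subgroup -/

namespace IsFreeConcatenation

open scoped Pointwise

variable {G : Type*} [Group G] {H : Subgroup G} {E S : Set G}

theorem exists_mem_notMem_of_finite [Infinite H] {B : Set G} (hB : B.Finite) :
    ∃ w ∈ H, w ∉ B := by
  have : (H : Set G).Infinite := Set.infinite_coe_iff.1 ‹_›
  obtain ⟨w, hw, hwB⟩ := this.exists_notMem_finite hB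
  exact ⟨w, hw, hwB⟩

theorem mem_of_conj_mem (hS : IsFreeConcatenation H E S) {s h : G} (hs : s ∈ S) (hh : h ∈ H)
    (hc : s * h * s⁻¹ ∈ H) : h ∈ E := by
  by_contra hE
  exact hS.notMem _ (hS.mul_mem s hs h hh hE _ (hS.inv_mem s hs)) hc

/-- The conjugates of `H` by an element of `S` are, outside `H`, products of elements of `S`
with elements of a finite subset of `H`. -/
theorem exists_finite_conj_eq (hS : IsFreeConcatenation H E S) {s : G} (hs : s ∈ S) :
    ∃ F : Set G, F.Finite ∧ F ⊆ H ∧ ∀ h ∈ H, s * h * s⁻¹ ∉ H →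
      ∃ a ∈ F, ∃ b ∈ F, ∃ s' ∈ S, s * h * s⁻¹ = a * s' * b := by
  have key : ∀ g : G, ∃ a ∈ H, ∃ b ∈ H, g ∉ H → ∃ s' ∈ S, g = a * s' * b := by
    intro g
    by_cases hg : g ∈ H
    · exact ⟨1, H.one_mem, 1, H.one_mem, fun h => absurd hg h⟩
    · obtain ⟨a, ha, s', hs', b, hb, h⟩ := hS.exists_eq g hg
      exact ⟨a, ha, b, hb, fun _ => ⟨s', hs', h⟩⟩
  choose α hα β hβ hαβ using key
  -- For h ∉ E the conjugate is already in S, so a = b = 1 works; only the finitely many h ∈ E need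
  -- chosen coefficients.
  refine ⟨{1} ∪ ((fun h => α (s * h * s⁻¹)) '' E ∪ (fun h => β (s * h * s⁻¹)) '' E),
    (Set.finite_singleton 1).union ((hS.finite.image _).union (hS.finite.image _)), ?_, ?_⟩
  · rintro x (rfl | ⟨h, -, rfl⟩ | ⟨h, -, rfl⟩)
    exacts [H.one_mem, hα _, hβ _]
  · intro h hh hc
    by_cases hE : h ∈ E
    · exact ⟨_, .inr (.inl ⟨h, hE, rfl⟩), _, .inr (.inr ⟨h, hE, rfl⟩), hαβ _ hc⟩
    · exact ⟨1, .inl rfl, 1, .inl rfl, _, hS.mul_mem s hs h hh hE _ (hS.inv_mem s hs), by simp⟩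

/-- Conjugates of `H` by long concatenations meet `H` in less than conjugates by an initial
part. -/
theorem exists_finite_conj_mem (hS : IsFreeConcatenation H E S) {s s' : G} (hs : s ∈ S)
    (hs' : s' ∈ S) :
    ∃ B : Set G, B.Finite ∧ ∀ w ∈ H, w ∉ B → s * w * s' ∈ S ∧
      ∀ x ∈ H, (s * w * s')⁻¹ * x * (s * w * s') ∈ H → s⁻¹ * x * s ∈ H := by
  obtain ⟨F, hF, hFH, hFS⟩ := hS.exists_finite_conj_eq hs'
  -- The last two sets exclude w * a ∈ E and b * w⁻¹ ∈ E for a, b ∈ F. Otherwise-reduced words s * w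
  -- * a * s'' * b * w⁻¹ * s⁻¹ then stay in S, hence outside H.
  refine ⟨E ∪ (E * F⁻¹ ∪ E⁻¹ * F), hS.finite.union
    ((hS.finite.mul hF.inv).union (hS.finite.inv.mul hF)), fun w hw hwB => ?_⟩
  simp only [Set.mem_union, not_or] at hwB
  obtain ⟨hwE, hw1, hw2⟩ := hwB
  refine ⟨hS.mul_mem s hs w hw hwE s' hs', fun x hx hxc => ?_⟩
  have hx' : x = s * (w * (s' * ((s * w * s')⁻¹ * x * (s * w * s')) * s'⁻¹) * w⁻¹) * s⁻¹ := by
    group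
  by_cases hc : s' * ((s * w * s')⁻¹ * x * (s * w * s')) * s'⁻¹ ∈ H
  · have : s⁻¹ * x * s = w * (s' * ((s * w * s')⁻¹ * x * (s * w * s')) * s'⁻¹) * w⁻¹ := by group
    rw [this]
    exact H.mul_mem (H.mul_mem hw hc) (H.inv_mem hw)
  · obtain ⟨a, ha, b, hb, s'', hs'', he⟩ := hFS _ hxc hc
    have h1 : w * a ∉ E := fun h => hw1 ⟨w * a, h, a⁻¹, by simpa using ha, by group⟩
    have h2 : b * w⁻¹ ∉ E := fun h => hw2 ⟨(b * w⁻¹)⁻¹, by simpa using h, b, hb, by group⟩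
    refine absurd hx (hS.notMem x ?_)
    rw [hx', he]
    have := hS.mul_mem _ (hS.mul_mem s hs _ (H.mul_mem hw (hFH ha)) h1 s'' hs'') _
      (H.mul_mem (hFH hb) (H.inv_mem hw)) h2 _ (hS.inv_mem s hs)
    convert this using 1
    group

theorem mem_normalCore (hS : IsFreeConcatenation H E S) {k : G} (hk : k ∈ H)
    (h : ∀ a ∈ H, ∀ s ∈ S, (a * s)⁻¹ * k * (a * s) ∈ H) : k ∈ H.normalCore := by
  intro g
  by_cases hg : g ∈ H
  · exact H.mul_mem (H.mul_mem hg hk) (H.inv_mem hg)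
  · obtain ⟨a, ha, s, hs, b, hb, hgs⟩ := hS.exists_eq g⁻¹ (by simpa using hg)
    have : g * k * g⁻¹ = b⁻¹ * ((a * s)⁻¹ * k * (a * s)) * b := by
      rw [show g = b⁻¹ * (a * s)⁻¹ by rw [← inv_inj, hgs]; group]
      group
    rw [this]
    exact H.mul_mem (H.mul_mem (H.inv_mem hb) (h a ha s hs)) hb

/-- Some conjugate of `H` meets `H` in the normal core. -/
theorem exists_conj_mem_normalCore [Infinite H] (hS : IsFreeConcatenation H E S) :
    ∃ s ∈ S, ∀ x ∈ H, s⁻¹ * x * s ∈ H → x ∈ H.normalCore := by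
  let C : G → Set G := fun s => {x | x ∈ H ∧ s⁻¹ * x * s ∈ H}
  have hC : ∀ s ∈ S, (C s).Finite := fun s hs => by
    refine (hS.finite.image fun h => s * h * s⁻¹).subset fun x hx => ?_
    refine ⟨s⁻¹ * x * s, hS.mem_of_conj_mem hs hx.2 ?_, by group⟩
    convert hx.1 using 1
    group
  -- Minimality upgrades C (s * w * s') ⊆ C s, valid for almost all w, to equality.
  obtain ⟨s, hs, hmin⟩ : ∃ s ∈ S, ∀ s' ∈ S, (C s).ncard ≤ (C s').ncard := by
    obtain ⟨n, ⟨s, hs, rfl⟩, hn⟩ := WellFounded.has_min Nat.lt_wfRel.wf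
      ((fun s => (C s).ncard) '' S) (hS.nonempty.image _)
    exact ⟨s, hs, fun s' hs' => not_lt.1 (hn _ ⟨s', hs', rfl⟩)⟩
  have hcof : ∀ s' ∈ S, ∃ B : Set G, B.Finite ∧ ∀ w ∈ H, w ∉ B → ∀ x ∈ C s,
      (s * w * s')⁻¹ * x * (s * w * s') ∈ H := by
    intro s' hs'
    obtain ⟨B, hB, h⟩ := hS.exists_finite_conj_mem hs hs'
    refine ⟨B, hB, fun w hw hwB x hx => ?_⟩
    obtain ⟨hmem, hsub⟩ := h w hw hwB
    have : C (s * w * s') = C s :=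
      Set.eq_of_subset_of_ncard_le (fun y hy => ⟨hy.1, hsub y hy.1 hy.2⟩) (hmin _ hmem) (hC s hs)
    exact (this ▸ hx : x ∈ C (s * w * s')).2
  refine ⟨s, hs, fun x hxH hxs => ?_⟩
  have hx : x ∈ C s := ⟨hxH, hxs⟩
  set k := s⁻¹ * x * s with hk
  obtain ⟨B, hB, hBs⟩ := hcof s hs
  have hinf : ((H : Set G) \ B).Infinite := (Set.infinite_coe_iff.1 ‹Infinite H›).sdiff hB
  have hmaps : ∀ w ∈ (H : Set G) \ B, w⁻¹ * k * w ∈ (fun h => s * h * s⁻¹) '' E := by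
    intro w hw
    have h1 := hBs w hw.1 hw.2 x hx
    have h2 : (s * w * s)⁻¹ * x * (s * w * s) = s⁻¹ * (w⁻¹ * k * w) * s := by
      rw [hk]; group
    rw [h2] at h1
    refine ⟨_, hS.mem_of_conj_mem hs h1 ?_, by group⟩
    convert H.mul_mem (H.mul_mem (H.inv_mem hw.1) hxs) hw.1 using 1
    group
  -- Pigeonhole: w⁻¹ * k * w takes values in a finite set. A value k' taken infinitely often can be
  -- tested against every a * s' by choosing w in its fibre outside the relevant bad set, which puts
  -- k' in the core.
  obtain ⟨k', hk', hfib⟩ : ∃ k', k' ∈ H ∧ {w | w ∈ H ∧ w⁻¹ * k * w = k'}.Infinite := by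
    by_contra! hcon
    refine hinf (((hS.finite.image fun h => s * h * s⁻¹).biUnion
      (t := fun k' => {w | w ∈ H ∧ w⁻¹ * k * w = k'}) fun k' _ => ?_).subset fun w hw =>
        Set.mem_biUnion (hmaps w hw) ⟨hw.1, rfl⟩)
    by_cases hk'H : k' ∈ H
    · exact hcon k' hk'H
    · convert Set.finite_empty using 1
      refine Set.eq_empty_of_forall_notMem fun w hw => hk'H ?_
      rw [← hw.2]
      exact H.mul_mem (H.mul_mem (H.inv_mem hw.1) hxs) hw.1
  have hcore : k' ∈ H.normalCore := by
    refine hS.mem_normalCore hk' fun a ha s' hs' => ?_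
    obtain ⟨B', hB', hBs'⟩ := hcof s' hs'
    obtain ⟨w, hw, hwB⟩ := hfib.exists_notMem_finite (hB'.mul (Set.finite_singleton a⁻¹))
    have h1 := hBs' (w * a) (H.mul_mem hw.1 ha)
      (fun h => hwB ⟨_, h, a⁻¹, rfl, by group⟩) x hx
    convert h1 using 1
    rw [← hw.2, hk]
    group
  obtain ⟨w, hw⟩ := hfib.nonempty
  have : x = (s * w) * k' * (s * w)⁻¹ := by rw [← hw.2, hk]; group
  rw [this]
  exact H.normalCore_normal.conj_mem k' hcore _

theorem finite_normalCore (hS : IsFreeConcatenation H E S) : Finite H.normalCore := by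
  obtain ⟨s, hs⟩ := hS.nonempty
  refine Set.Finite.to_subtype (hS.finite.subset fun x hx => ?_)
  exact hS.mem_of_conj_mem hs (H.normalCore_le hx)
    (H.normalCore_le (H.normalCore_normal.conj_mem x hx s))

theorem isLargestFiniteNormal_normalCore [Infinite H] (hS : IsFreeConcatenation H E S) :
    IsLargestFiniteNormal H.normalCore := by
  refine ⟨⟨H.normalCore_normal, hS.finite_normalCore⟩, fun N hN => ?_⟩
  obtain ⟨hNn, hNf⟩ := hN
  refine (Subgroup.normal_le_normalCore (hN := hNn)).2 fun n hn => ?_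
  by_contra hnH
  obtain ⟨a, ha, s, hs, b, hb, rfl⟩ := hS.exists_eq n hnH
  have hm : s * b * a ∈ N := by
    have := hNn.conj_mem _ hn a⁻¹
    convert this using 1
    group
  -- H conjugates an element of the finite group N into finitely many elements, so infinitely many
  -- elements of H commute with s * b * a; each of them has a conjugate by b * a in the finite set
  -- E.
  obtain ⟨y, hy⟩ := Finite.exists_infinite_fiber
    (fun w : H => (⟨w * (s * b * a) * (w : G)⁻¹, hNn.conj_mem _ hm w⟩ : N))
  obtain ⟨⟨w₀, hw₀⟩⟩ := hy.nonempty
  rw [← hw₀] at hy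
  refine Set.infinite_coe_iff.1 hy (((hS.finite.image fun e =>
    (w₀ : G) * ((b * a)⁻¹ * e * (b * a))).preimage
      Subtype.coe_injective.injOn).subset fun w hw => ?_)
  have hw' : (w : G) * (s * b * a) * (w : G)⁻¹ = w₀ * (s * b * a) * (w₀ : G)⁻¹ :=
    congrArg Subtype.val hw
  have hcomm : s * ((b * a) * ((w₀ : G)⁻¹ * w) * (b * a)⁻¹) * s⁻¹ = (w₀ : G)⁻¹ * w := by
    have : (w₀ : G)⁻¹ * w * (s * b * a) = (s * b * a) * ((w₀ : G)⁻¹ * w) := by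
      have h2 := congrArg (fun z => (w₀ : G)⁻¹ * z * w) hw'
      simpa [mul_assoc] using h2
    have h3 : (w₀ : G)⁻¹ * w = (s * b * a) * ((w₀ : G)⁻¹ * w) * (s * b * a)⁻¹ := by
      rw [← this]; group
    conv_rhs => rw [h3]
    group
  have hba := H.mul_mem hb ha
  have hww : (w₀ : G)⁻¹ * w ∈ H := H.mul_mem (H.inv_mem w₀.2) w.2
  refine ⟨_, hS.mem_of_conj_mem hs
    (H.mul_mem (H.mul_mem hba hww) (H.inv_mem hba)) (by rwa [hcomm]), ?_⟩
  simp [mul_assoc]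

/-! ### Embedding the HNN extension -/

/-- A homomorphism from an HNN extension along an identity map is injective if it maps the base and
the stable letter to elements that can be concatenated along reduced words. -/
theorem injective_of_concatenation (hS : IsFreeConcatenation H E S) {K : Type*} [Group K]
    {X : Subgroup K} (ψ : HNNExtension K X X (MulEquiv.refl X) →* G) {p q σ : ℤˣ → G}
    (hp : ∀ u, p u ∈ H) (hq : ∀ u, q u ∈ H) (hσ : ∀ u, σ u ∈ S)
    (ht : ∀ u : ℤˣ, ψ HNNExtension.t ^ (u : ℤ) = p u * σ u * q u)
    (hX : ∀ x ∈ X, ψ (HNNExtension.of x) ∈ H)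
    (hX1 : ∀ x ∈ X, ψ (HNNExtension.of x) = 1 → x = 1)
    (hXE : ∀ x ∈ X, ∀ u, q u * ψ (HNNExtension.of x) * p u ∉ E)
    (hK : ∀ k ∉ X, ∃ a ∈ H, ∃ s ∈ S, ∃ b ∈ H, ψ (HNNExtension.of k) = a * s * b ∧
      ∀ u, q u * a ∉ E ∧ b * p u ∉ E) :
    Function.Injective ψ := by
  have key : ∀ (l : List (ℤˣ × K)) (u : ℤˣ) (k : K),
      ((u, k) :: l).IsChain
        (fun a b => a.2 ∈ HNNExtension.toSubgroup X X a.1 → a.1 = b.1) →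
      ∃ s ∈ S, ∃ c ∈ H, ψ ((((u, k) :: l).map
        fun x => HNNExtension.t ^ (x.1 : ℤ) * HNNExtension.of x.2).prod) = p u * s * c := by
    intro l
    induction l with
    | nil =>
      intro u k _
      simp only [List.map_cons, List.map_nil, List.prod_cons, List.prod_nil, mul_one, map_mul,
        map_zpow, ht]
      by_cases hk : k ∈ X
      · exact ⟨σ u, hσ u, _, H.mul_mem (hq u) (hX k hk), by simp only [mul_assoc]⟩
      · obtain ⟨a, ha, s, hs, b, hb, he, hE⟩ := hK k hk
        refine ⟨_, hS.mul_mem _ (hσ u) _ (H.mul_mem (hq u) ha) (hE u).1 s hs, b, hb, ?_⟩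
        rw [he]
        simp only [mul_assoc]
    | cons v l ih =>
      obtain ⟨v, k'⟩ := v
      intro u k hc
      rw [List.isChain_cons_cons] at hc
      obtain ⟨s', hs', c, hcH, hprod⟩ := ih v k' hc.2
      rw [List.map_cons, List.prod_cons, map_mul, hprod, map_mul, map_zpow, ht]
      by_cases hk : k ∈ X
      -- Reducedness forces equal signs around an element of X, so only the products in `hXE` occur
      -- there.
      · have huv : u = v := hc.1 (by rcases Int.units_eq_one_or u with rfl | rfl <;> exact hk)
        subst huv
        refine ⟨_, hS.mul_mem _ (hσ u) _ (H.mul_mem (H.mul_mem (hq u) (hX k hk)) (hp u))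
          (hXE k hk u) s' hs', c, hcH, ?_⟩
        simp only [mul_assoc]
      · obtain ⟨a, ha, s, hs, b, hb, he, hE⟩ := hK k hk
        refine ⟨_, hS.mul_mem _ (hS.mul_mem _ (hσ u) _ (H.mul_mem (hq u) ha) (hE u).1 s hs) _
          (H.mul_mem hb (hp v)) (hE v).2 s' hs', c, hcH, ?_⟩
        rw [he]
        simp only [mul_assoc]
  refine (injective_iff_map_eq_one ψ).2 fun x hx => ?_
  obtain ⟨d⟩ := HNNExtension.NormalWord.TransversalPair.nonempty K X X
  obtain ⟨w, rfl⟩ : ∃ w : HNNExtension.NormalWord.ReducedWord K X X, w.prod (MulEquiv.refl X) = x :=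
    ⟨(x • (HNNExtension.NormalWord.empty : HNNExtension.NormalWord d)).toReducedWord, by
      rw [HNNExtension.NormalWord.prod_smul, HNNExtension.NormalWord.prod_empty, mul_one]⟩
  obtain ⟨k, l, hl⟩ := w
  simp only [HNNExtension.NormalWord.ReducedWord.prod] at hx ⊢
  cases l with
  | nil =>
    simp only [List.map_nil, List.prod_nil, mul_one] at hx ⊢
    by_cases hk : k ∈ X
    · rw [hX1 k hk hx, map_one]
    · obtain ⟨a, ha, s, hs, b, hb, he, -⟩ := hK k hk
      rw [he] at hx
      refine absurd ?_ (hS.notMem s hs)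
      rw [show s = a⁻¹ * (a * s * b) * b⁻¹ by group, hx, mul_one]
      exact H.mul_mem (H.inv_mem ha) (H.inv_mem hb)
  | cons v l =>
    exfalso
    obtain ⟨v, k'⟩ := v
    obtain ⟨s', hs', c, hc, hprod⟩ := key l v k' hl
    rw [map_mul, hprod] at hx
    by_cases hk : k ∈ X
    · refine hS.notMem s' hs' ?_
      have hm := H.mul_mem (hX k hk) (hp v)
      rw [show s' = (ψ (HNNExtension.of k) * p v)⁻¹ * (ψ (HNNExtension.of k) * (p v * s' * c)) *
        c⁻¹ by group, hx, mul_one]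
      exact H.mul_mem (H.inv_mem hm) (H.inv_mem hc)
    · obtain ⟨a, ha, s, hs, b, hb, he, hE⟩ := hK k hk
      refine hS.notMem _ (hS.mul_mem s hs _ (H.mul_mem hb (hp v)) (hE v).2 s' hs') ?_
      rw [he] at hx
      rw [show s * (b * p v) * s' = a⁻¹ * (a * s * b * (p v * s' * c)) * c⁻¹ by group, hx, mul_one]
      exact H.mul_mem (H.inv_mem ha) (H.inv_mem hc)

/-- An infinite group contains infinitely many elements centralizing a given finite normal
subgroup. -/
theorem exists_mem_centralizing_notMem [Infinite H] (X : Subgroup G) [X.Normal] [Finite X]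
    {B : Set G} (hB : B.Finite) : ∃ w ∈ H, w ∉ B ∧ ∀ x ∈ X, w * x = x * w := by
  obtain ⟨y, hy⟩ := Finite.exists_infinite_fiber
    (fun w : H => (MulAut.conjNormal (w : G) : MulAut X).toEquiv)
  obtain ⟨⟨w₀, hw₀⟩⟩ := hy.nonempty
  obtain ⟨w, hw, hwB⟩ := (Set.infinite_coe_iff.1 hy).exists_notMem_finite
    ((hB.image fun b => (w₀ : G) * b).preimage Subtype.coe_injective.injOn)
  refine ⟨(w₀ : G)⁻¹ * w, H.mul_mem (H.inv_mem w₀.2) w.2, fun h => hwB ⟨_, h, by simp⟩, ?_⟩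
  intro x hx
  have h1 := congrArg (fun e : X ≃ X => (e ⟨x, hx⟩ : G)) (hw.trans hw₀.symm)
  have h2 : (w : G) * x * (w : G)⁻¹ = w₀ * x * (w₀ : G)⁻¹ := by simpa using h1
  have h3 := congrArg (fun z => (w₀ : G)⁻¹ * z * w) h2
  simpa [mul_assoc] using h3

/-- The base is conjugated by (s * w)⁻¹ and the stable letter goes to r * w₂ with r = s * w₁ * s⁻¹.
Here s makes s⁻¹ * h * s leave H for h ∉ X, w keeps the outer coefficients of these elements away
from E, and w₂ separates consecutive copies of r, since X itself lies in E. -/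
theorem exists_injective_hnnExtension [Infinite H] (hS : IsFreeConcatenation H E S) :
    ∃ ψ : HNNExtension H (H.normalCore.subgroupOf H) (H.normalCore.subgroupOf H)
      (MulEquiv.refl (H.normalCore.subgroupOf H)) →* G, Function.Injective ψ := by
  have hXf : Finite H.normalCore := hS.finite_normalCore
  have hXn : H.normalCore.Normal := H.normalCore_normal
  set X := H.normalCore with hXdef
  have hXfin : (X : Set G).Finite := Set.toFinite _
  have hXH : X ≤ H := H.normalCore_le
  obtain ⟨s, hs, hsX⟩ := hS.exists_conj_mem_normalCore
  obtain ⟨w₁, hw₁, hw₁E, hw₁c⟩ := exists_mem_centralizing_notMem (H := H) X hS.finite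
  obtain ⟨w₂, hw₂, hw₂E, hw₂c⟩ := exists_mem_centralizing_notMem (H := H) X
    ((hS.finite.mul hXfin).union (hS.finite.inv.mul hXfin))
  obtain ⟨F, hF, hFH, hFS⟩ := hS.exists_finite_conj_eq (hS.inv_mem s hs)
  have hP : ({1, w₂} : Set G).Finite := Set.toFinite _
  obtain ⟨w, hw, hwE⟩ := exists_mem_notMem_of_finite (H := H)
    (((hF.mul hS.finite.inv).mul hP).union ((hF.inv.mul hS.finite).mul hP))
  simp only [Set.mem_union, not_or] at hw₂E hwE
  have hwF₁ : ∀ a ∈ F, ∀ c ∈ ({1, w₂} : Set G), c * (w⁻¹ * a) ∉ E := fun a ha c hc h =>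
    hwE.1 (by
      convert Set.mul_mem_mul (Set.mul_mem_mul ha (Set.inv_mem_inv.2 h)) hc using 1
      group)
  have hwF₂ : ∀ b ∈ F, ∀ c ∈ ({1, w₂} : Set G), b * w * c⁻¹ ∉ E := fun b hb c hc h =>
    hwE.2 (by
      convert Set.mul_mem_mul (Set.mul_mem_mul (Set.inv_mem_inv.2 hb) h) hc using 1
      group)
  have hσ : s * w₁ * s⁻¹ ∈ S := hS.mul_mem s hs w₁ hw₁ hw₁E _ (hS.inv_mem s hs)
  have hrc : ∀ x ∈ X, (s * w₁ * s⁻¹ * w₂) * x = x * (s * w₁ * s⁻¹ * w₂) := by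
    intro x hx
    -- X is normal, so w₁ also commutes with s⁻¹ * x * s; conjugating back, r commutes with x.
    have h1 := hw₁c _ (hXn.conj_mem x hx s⁻¹)
    have h2 : s * w₁ * s⁻¹ * x = x * (s * w₁ * s⁻¹) := by
      have h3 := congrArg (fun z => s * z * s⁻¹) h1
      simpa [mul_assoc] using h3
    rw [mul_assoc, hw₂c x hx, ← mul_assoc, h2, mul_assoc]
  let β : H →* G := (MulAut.conj (s * w)⁻¹).toMonoidHom.comp H.subtype
  have hβ : ∀ h : H, β h = w⁻¹ * (s⁻¹ * h * s) * w := fun h => by simp [β, mul_assoc]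
  have hβX : ∀ h ∈ X.subgroupOf H, β h ∈ X := fun h hh => by
    simpa [β, mul_assoc] using hXn.conj_mem h hh (s * w)⁻¹
  obtain ⟨ψ, hψ, hψt⟩ : ∃ ψ : HNNExtension H (X.subgroupOf H) (X.subgroupOf H)
      (MulEquiv.refl (X.subgroupOf H)) →* G,
      (∀ h, ψ (HNNExtension.of h) = β h) ∧ ψ HNNExtension.t = s * w₁ * s⁻¹ * w₂ := by
    have hc : ∀ a : X.subgroupOf H, (s * w₁ * s⁻¹ * w₂) * β a =
        β (MulEquiv.refl (X.subgroupOf H) a : X.subgroupOf H) * (s * w₁ * s⁻¹ * w₂) := fun a => by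
      rw [MulEquiv.refl_apply]
      exact hrc _ (hβX a a.2)
    exact ⟨HNNExtension.lift β _ hc, HNNExtension.lift_of β _ hc, HNNExtension.lift_t β _ hc⟩
  refine ⟨ψ, ?_⟩
  refine hS.injective_of_concatenation _ (p := fun u => if u = 1 then 1 else w₂⁻¹)
    (q := fun u => if u = 1 then w₂ else 1) (σ := fun u => (s * w₁ * s⁻¹) ^ (u : ℤ))
    ?_ ?_ ?_ ?_ ?_ ?_ ?_ ?_
  · intro u
    split_ifs
    exacts [H.one_mem, H.inv_mem hw₂]
  · intro u
    split_ifs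
    exacts [hw₂, H.one_mem]
  · intro u
    rcases Int.units_eq_one_or u with rfl | rfl
    · simpa using hσ
    · simpa [mul_assoc] using hS.inv_mem _ hσ
  · intro u
    rcases Int.units_eq_one_or u with rfl | rfl
    · simp [hψt]
    · simp [hψt, mul_assoc]
  · intro x hx
    rw [hψ]
    exact hXH (hβX x hx)
  · intro x _ hx1
    rw [hψ] at hx1
    exact (injective_iff_map_eq_one β).1
      ((MulAut.conj (s * w)⁻¹).injective.comp H.subtype_injective) x hx1
  · intro x hx u h
    rw [hψ] at h
    rcases Int.units_eq_one_or u with rfl | rfl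
    · refine hw₂E.1 ?_
      convert Set.mul_mem_mul h (X.inv_mem (hβX x hx)) using 1
      simp
    · refine hw₂E.2 ?_
      convert Set.mul_mem_mul (Set.inv_mem_inv.2 h) (hβX x hx) using 1
      simp
  · intro k hk
    have hkc : s⁻¹ * k * s⁻¹⁻¹ ∉ H := fun h => hk (hsX k k.2 (by simpa using h))
    obtain ⟨a, ha, b, hb, s', hs', he⟩ := hFS k k.2 hkc
    rw [inv_inv] at he
    refine ⟨w⁻¹ * a, H.mul_mem (H.inv_mem hw) (hFH ha), s', hs', b * w, H.mul_mem (hFH hb) hw,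
      ?_, fun u => ?_⟩
    · rw [hψ, hβ, he]
      simp only [mul_assoc]
    · rcases Int.units_eq_one_or u with rfl | rfl
      · exact ⟨by simpa using hwF₁ a ha w₂ (by simp), by simpa using hwF₂ b hb 1 (by simp)⟩
      · exact ⟨by simpa using hwF₁ a ha 1 (by simp), by simpa using hwF₂ b hb w₂ (by simp)⟩

end IsFreeConcatenation

/-! ### Amalgamated products -/

/-- The products of elements of `K \ A` and elements of `H \ A` that alternate between the two,
and start and end with an element of `K \ A`. -/
inductive AlternatingProduct {G : Type*} [Group G] (A H K : Subgroup G) : G → Prop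
  | letter (b : G) : b ∈ K → b ∉ A → AlternatingProduct A H K b
  | mul (s w s' : G) : AlternatingProduct A H K s → w ∈ H → w ∉ A → AlternatingProduct A H K s' →
      AlternatingProduct A H K (s * w * s')

namespace AlternatingProduct

variable {G : Type*} [Group G] {A H K : Subgroup G}

theorem inv {s : G} (hs : AlternatingProduct A H K s) : AlternatingProduct A H K s⁻¹ := by
  induction hs with
  | letter b hb hbA => exact .letter _ (K.inv_mem hb) (by simpa using hbA)
  | mul s w s' _ hw hwA _ ih ih' =>
    rw [show (s * w * s')⁻¹ = s'⁻¹ * w⁻¹ * s⁻¹ by group]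
    exact .mul _ _ _ ih' (H.inv_mem hw) (by simpa using hwA) ih

theorem mul_left_mem_or (hAH : A ≤ H) {b s : G} (hb : b ∈ K) (hs : AlternatingProduct A H K s) :
    b * s ∈ H ∨ ∃ a ∈ H, ∃ s', AlternatingProduct A H K s' ∧ b * s = a * s' := by
  induction hs with
  | letter b' hb' _ =>
    by_cases h : b * b' ∈ A
    · exact .inl (hAH h)
    · exact .inr ⟨1, H.one_mem, _, .letter _ (K.mul_mem hb hb') h, by simp⟩
  | mul s w s' hs hw hwA hs' ih ih' =>
    right
    rcases ih with h | ⟨a, ha, s'', hs'', he⟩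
    · exact ⟨b * s * w, H.mul_mem h hw, s', hs', by simp only [mul_assoc]⟩
    · exact ⟨a, ha, _, .mul s'' w s' hs'' hw hwA hs', by
        rw [← mul_assoc, ← mul_assoc, he]; simp only [mul_assoc]⟩

/-- H ∪ HSH is stable under left multiplication by K; as the factors generate, it is the whole
group. -/
theorem mul_left_eq (hAH : A ≤ H) (hAK : A ≤ K) {b g : G} (hb : b ∈ K)
    (hg : g ∈ H ∨ ∃ a ∈ H, ∃ s, AlternatingProduct A H K s ∧ ∃ c ∈ H, g = a * s * c) :
    b * g ∈ H ∨ ∃ a ∈ H, ∃ s, AlternatingProduct A H K s ∧ ∃ c ∈ H, b * g = a * s * c := by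
  by_cases hbA : b ∈ A
  · rcases hg with hg | ⟨a, ha, s, hs, c, hc, rfl⟩
    · exact .inl (H.mul_mem (hAH hbA) hg)
    · exact .inr ⟨b * a, H.mul_mem (hAH hbA) ha, s, hs, c, hc, by simp only [mul_assoc]⟩
  rcases hg with hg | ⟨a, ha, s, hs, c, hc, rfl⟩
  · exact .inr ⟨1, H.one_mem, b, .letter b hb hbA, g, hg, by simp⟩
  by_cases haA : a ∈ A
  · rcases mul_left_mem_or hAH (K.mul_mem hb (hAK haA)) hs with h | ⟨a', ha', s', hs', he⟩
    · exact .inl (by simpa only [mul_assoc] using H.mul_mem h hc)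
    · exact .inr ⟨a', ha', s', hs', c, hc, by rw [← he]; simp only [mul_assoc]⟩
  · exact .inr ⟨1, H.one_mem, _, .mul b a s (.letter b hb hbA) ha haA hs, c, hc, by
      simp only [mul_assoc, one_mul]⟩

open Monoid in
theorem notMem {K : Bool → Subgroup G} {φ : ∀ i, A →* K i} (hφ : ∀ i a, (φ i a : G) = a)
    (f : PushoutI φ ≃* G)
    (hf : ∀ (i : Bool) (k : K i), f (PushoutI.of i k) = (k : G))
    (i : Bool) {s : G} (hs : AlternatingProduct A (K i) (K !i) s) : s ∉ K i := by
  have hinj : ∀ i, Function.Injective (φ i) := fun i a b hab => Subtype.ext (by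
    rw [← hφ i a, hab, hφ])
  have hrange : ∀ (j : Bool) (k : K j), (k : G) ∉ A → k ∉ (φ j).range := by
    rintro j k hk ⟨a, rfl⟩
    exact hk (hφ j a ▸ a.2)
  have hbase : ∀ a : A, f (PushoutI.base φ a) = a := fun a => by
    rw [← PushoutI.of_apply_eq_base φ i, hf, hφ]
  have hone : ∀ (j : Bool) (k : K j), (k : G) ∉ A → k ≠ 1 := by
    rintro j k hk rfl
    exact hk A.one_mem
  have hij : i ≠ !i := by cases i <;> decide
  have key : ∃ w : CoprodI.NeWord (fun i => K i) (!i) (!i),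
      PushoutI.Reduced φ w.toWord ∧ f (PushoutI.ofCoprodI w.prod) = s := by
    induction hs with
    | letter b hb hbA =>
      refine ⟨.singleton ⟨b, hb⟩ (hone _ _ hbA), ?_, ?_⟩
      · intro g hg
        obtain rfl : g = ⟨!i, ⟨b, hb⟩⟩ := by simpa [CoprodI.NeWord.toWord] using hg
        exact hrange _ _ hbA
      · simp [hf]
    | mul s w s' _ hw hwA _ ih ih' =>
      obtain ⟨v, hv, rfl⟩ := ih
      obtain ⟨v', hv', rfl⟩ := ih'
      refine ⟨.append (.append v hij.symm (.singleton ⟨w, hw⟩ (hone _ _ hwA))) hij v', ?_, ?_⟩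
      · intro g hg
        have hg' : (g ∈ v.toList ∨ g = ⟨i, ⟨w, hw⟩⟩) ∨ g ∈ v'.toList := by
          simpa [CoprodI.NeWord.toWord, or_assoc] using hg
        rcases hg' with (hg | rfl) | hg
        exacts [hv g hg, hrange _ _ hwA, hv' g hg]
      · simp [hf]
  obtain ⟨w, hw, rfl⟩ := key
  intro hmem
  -- A product in A contradicts the normal form theorem directly. One in K i outside A becomes,
  -- after appending its inverse, a nonempty reduced word with product 1.
  by_cases hA : f (PushoutI.ofCoprodI w.prod) ∈ A
  · have := hw.eq_empty_of_mem_range hinj ⟨⟨_, hA⟩, f.injective (hbase _)⟩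
    exact w.toList_ne_nil (congrArg CoprodI.Word.toList this)
  · have hA' : (f (PushoutI.ofCoprodI w.prod))⁻¹ ∉ A := by simpa using hA
    let w' : CoprodI.NeWord (fun i => K i) (!i) i :=
      .append w hij.symm (.singleton ⟨_, (K i).inv_mem hmem⟩ (hone _ _ hA'))
    have hw' : PushoutI.Reduced φ w'.toWord := by
      intro g hg
      have hg' : g ∈ w.toList ∨ g = ⟨i, ⟨_, (K i).inv_mem hmem⟩⟩ := by
        simpa [w', CoprodI.NeWord.toWord] using hg
      rcases hg' with hg | rfl
      exacts [hw g hg, hrange _ _ hA']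
    have hprod : PushoutI.ofCoprodI (φ := φ) w'.prod = 1 := f.injective (by simp [w', hf])
    have := hw'.eq_empty_of_mem_range hinj
      (by rw [show w'.toWord.prod = w'.prod from rfl, hprod]; exact one_mem _)
    exact w'.toList_ne_nil (congrArg CoprodI.Word.toList this)

end AlternatingProduct

open Monoid in
theorem IsNontrivialAmalgam.isFreeConcatenation {G : Type*} [Group G] {A : Subgroup G}
    {K : Bool → Subgroup G} (h : IsNontrivialAmalgam A K) (hA : Finite A) (i : Bool) :
    IsFreeConcatenation (K i) (A : Set G) {s | AlternatingProduct A (K i) (K !i) s} := by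
  obtain ⟨hne, hAK, f, hf⟩ := h
  refine ⟨Set.toFinite _, ?_, fun s hs => hs.inv, fun s hs w hw hwA s' hs' => .mul _ _ _ hs hw hwA hs',
    fun s hs => hs.notMem (fun _ _ => rfl) f hf i, fun g hg => ?_⟩
  · obtain ⟨b, hb, hbA⟩ := SetLike.exists_of_lt (lt_of_le_of_ne (hAK !i) (hne !i))
    exact ⟨b, .letter b hb hbA⟩
  · have key : ∀ (x : PushoutI (fun i => Subgroup.inclusion (hAK i))) (g : G),
        (g ∈ K i ∨ ∃ a ∈ K i, ∃ s, AlternatingProduct A (K i) (K !i) s ∧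
          ∃ c ∈ K i, g = a * s * c) →
        (f x * g ∈ K i ∨ ∃ a ∈ K i, ∃ s, AlternatingProduct A (K i) (K !i) s ∧
          ∃ c ∈ K i, f x * g = a * s * c) := by
      have hleft : ∀ k ∈ K i, ∀ g : G,
          (g ∈ K i ∨ ∃ a ∈ K i, ∃ s, AlternatingProduct A (K i) (K !i) s ∧
            ∃ c ∈ K i, g = a * s * c) →
          (k * g ∈ K i ∨ ∃ a ∈ K i, ∃ s, AlternatingProduct A (K i) (K !i) s ∧
            ∃ c ∈ K i, k * g = a * s * c) := by
        rintro k hk g (hg | ⟨a, ha, s, hs, c, hc, rfl⟩)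
        · exact .inl ((K i).mul_mem hk hg)
        · exact .inr ⟨k * a, (K i).mul_mem hk ha, s, hs, c, hc, by simp only [mul_assoc]⟩
      intro x
      induction x using PushoutI.induction_on with
      | of j k =>
        intro g hg
        rw [hf]
        rcases Bool.eq_or_eq_not j i with rfl | rfl
        · exact hleft k k.2 g hg
        · exact AlternatingProduct.mul_left_eq (hAK i) (hAK _) k.2 hg
      | base a =>
        intro g hg
        rw [← PushoutI.of_apply_eq_base _ i, hf]
        exact hleft _ (Subtype.prop _) g hg
      | mul x y ihx ihy =>
        intro g hg
        rw [map_mul, mul_assoc]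
        exact ihx _ (ihy _ hg)
    have := key (f.symm g) 1 (.inl (one_mem _))
    rw [f.apply_symm_apply, mul_one] at this
    exact this.resolve_left hg

/-! ### HNN extensions -/

/-- The elements of a group that are products of the form `t ^ u * w * ⋯ * w' * t ^ v` without
subwords `t ^ u * a * t ^ (-u)` with `a ∈ D u`, where all letters other than the powers of `t` are
in `H`. -/
inductive BrittonProduct {G : Type*} [Group G] (H : Subgroup G) (D : ℤˣ → Subgroup H) (t : G) :
    ℤˣ → ℤˣ → G → Prop
  | letter (u : ℤˣ) : BrittonProduct H D t u u (t ^ (u : ℤ))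
  | mul (u v u' v' : ℤˣ) (s : G) (w : H) (s' : G) : BrittonProduct H D t u v s →
      (w ∈ D v → v = u') → BrittonProduct H D t u' v' s' →
      BrittonProduct H D t u v' (s * w * s')

namespace BrittonProduct

variable {G : Type*} [Group G] {H : Subgroup G} {D : ℤˣ → Subgroup H} {t : G}

theorem inv {u v : ℤˣ} {s : G} (hs : BrittonProduct H D t u v s) :
    BrittonProduct H D t (-v) (-u) s⁻¹ := by
  induction hs with
  | letter u => simpa using BrittonProduct.letter (H := H) (D := D) (t := t) (-u)
  | mul u v u' v' s w s' _ hw _ ih ih' =>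
    rw [show (s * w * s')⁻¹ = s'⁻¹ * (w⁻¹ : H) * s⁻¹ by push_cast; group]
    refine .mul _ _ _ _ _ _ _ ih' (fun hm => ?_) ih
    rw [inv_mem_iff] at hm
    by_cases huv : v = u'
    · rw [huv]
    · have : -u' = v := (Int.units_ne_iff_eq_neg.1 huv).symm
      exact absurd (hw (this ▸ hm)) huv

theorem mul_left_mem_or {x v : ℤˣ} {s : G} (hs : BrittonProduct H D t x v s) :
    t ^ (-x : ℤ) * s ∈ H ∨ ∃ a ∈ H, ∃ u s', BrittonProduct H D t u v s' ∧
      t ^ (-x : ℤ) * s = a * s' := by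
  induction hs with
  | letter u => exact .inl (by rw [zpow_neg, inv_mul_cancel]; exact H.one_mem)
  | mul u v u' v' s w s' hs hw hs' ih ih' =>
    right
    rcases ih with h | ⟨a, ha, u'', s'', hs'', he⟩
    · exact ⟨_, H.mul_mem h w.2, u', s', hs', by simp only [mul_assoc]⟩
    · exact ⟨a, ha, u'', _, .mul _ _ _ _ _ _ _ hs'' hw hs', by
        rw [← mul_assoc, ← mul_assoc, he]; simp only [mul_assoc]⟩

/-- If t ^ x meets a pinch, it moves past a and cancels the leading letter of s; otherwise the
longer word is still reduced. -/
theorem mul_left_eq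
    (hD : ∀ u, ∀ w ∈ D u, ∃ w' ∈ H, t ^ (u : ℤ) * w = w' * t ^ (u : ℤ)) (x : ℤˣ) {g : G}
    (hg : g ∈ H ∨ ∃ a ∈ H, ∃ s, (∃ u v, BrittonProduct H D t u v s) ∧ ∃ c ∈ H, g = a * s * c) :
    t ^ (x : ℤ) * g ∈ H ∨ ∃ a ∈ H, ∃ s, (∃ u v, BrittonProduct H D t u v s) ∧
      ∃ c ∈ H, t ^ (x : ℤ) * g = a * s * c := by
  rcases hg with hg | ⟨a, ha, s, ⟨u, v, hs⟩, c, hc, rfl⟩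
  · exact .inr ⟨1, H.one_mem, _, ⟨x, x, .letter x⟩, g, hg, by simp⟩
  by_cases hax : (⟨a, ha⟩ : H) ∈ D x → x = u
  · exact .inr ⟨1, H.one_mem, _, ⟨x, v, .mul _ _ _ _ _ ⟨a, ha⟩ _ (.letter x) hax hs⟩, c, hc, by
      simp only [mul_assoc, one_mul]⟩
  · push Not at hax
    obtain ⟨haD, hxu⟩ := hax
    have hx : (x : ℤ) = -u := by rw [Int.units_ne_iff_eq_neg.1 hxu, Units.val_neg]
    obtain ⟨a', ha', he⟩ := hD x _ haD
    have he' : t ^ (x : ℤ) * (a * s * c) = a' * (t ^ (-u : ℤ) * s) * c := by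
      rw [← hx, ← mul_assoc, ← mul_assoc, he]
      simp only [mul_assoc]
    rw [he']
    rcases hs.mul_left_mem_or with h | ⟨b, hb, u', s', hs', he''⟩
    · exact .inl (H.mul_mem (H.mul_mem ha' h) hc)
    · exact .inr ⟨a' * b, H.mul_mem ha' hb, s', ⟨u', v, hs'⟩, c, hc, by
        rw [he'']; simp only [mul_assoc]⟩

theorem notMem {A B : Subgroup H} {φ : A ≃* B} (f : HNNExtension H A B φ ≃* G)
    (hf : ∀ h : H, f (HNNExtension.of h) = (h : G)) {u v : ℤˣ} {s : G}
    (hs : BrittonProduct H (HNNExtension.toSubgroup A B) (f HNNExtension.t) u v s) : s ∉ H := by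
  -- Flattening to a reduced word is proved with an arbitrary reduced tail, so that the two halves
  -- of a concatenation can be spliced; Britton's lemma then applies.
  have key : ∀ (w : H) (l : List (ℤˣ × H)),
      l.IsChain (fun a b => a.2 ∈ HNNExtension.toSubgroup A B a.1 → a.1 = b.1) →
      (∀ x ∈ l.head?, w ∈ HNNExtension.toSubgroup A B v → v = x.1) →
      ∃ (k : H) (l' : List (ℤˣ × H)), ((u, k) :: l').IsChain
        (fun a b => a.2 ∈ HNNExtension.toSubgroup A B a.1 → a.1 = b.1) ∧
        f (((u, k) :: l').map
          fun x => HNNExtension.t ^ (x.1 : ℤ) * HNNExtension.of x.2).prod =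
        s * w * f (l.map fun x => HNNExtension.t ^ (x.1 : ℤ) * HNNExtension.of x.2).prod := by
    induction hs with
    | letter u =>
      intro w l hl hw
      exact ⟨w, l, List.isChain_cons.2 ⟨hw, hl⟩, by simp [hf]⟩
    | mul u v u' v' s w₀ s' _ hw₀ _ ih ih' =>
      intro w l hl hw
      obtain ⟨k', l', hl', he'⟩ := ih' w l hl hw
      obtain ⟨k, l'', hl'', he''⟩ := ih w₀ _ hl' (by simpa using hw₀)
      exact ⟨k, l'', hl'', by rw [he'', he']; simp only [mul_assoc]⟩
  obtain ⟨k, l, hl, he⟩ := key 1 [] List.isChain_nil (by simp)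
  intro hsH
  have := HNNExtension.ReducedWord.toList_eq_nil_of_mem_of_range (φ := φ)
    ⟨1, (u, k) :: l, hl⟩ ⟨⟨s, hsH⟩, f.injective (by
      rw [hf, HNNExtension.NormalWord.ReducedWord.prod, map_mul, he]; simp)⟩
  simp at this

end BrittonProduct

theorem IsHNNDecomposition.exists_isFreeConcatenation {G : Type*} [Group G] {A H : Subgroup G}
    (h : IsHNNDecomposition A H) (hA : Finite A) : ∃ E S : Set G, IsFreeConcatenation H E S := by
  obtain ⟨hAH, B, φ, f, hf⟩ := h
  have hA' : Finite (A.subgroupOf H) :=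
    Finite.of_injective (fun a => (⟨((a : H) : G), a.2⟩ : A)) fun a b hab => 
      Subtype.ext (Subtype.ext (congrArg (fun z : A => (z : G)) hab))
  have hB : Finite B := Finite.of_equiv _ φ.toEquiv
  set D := HNNExtension.toSubgroup (A.subgroupOf H) B with hDdef
  set t := f HNNExtension.t with ht
  have hD : ∀ u, ∀ w ∈ D u, ∃ w' ∈ H, t ^ (u : ℤ) * w = w' * t ^ (u : ℤ) := by
    intro u w hw
    rcases Int.units_eq_one_or u with rfl | rfl
    · refine ⟨_, (φ ⟨w, hw⟩ : H).2, ?_⟩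
      simpa [ht, hf] using congrArg f (HNNExtension.t_mul_of (φ := φ) ⟨w, hw⟩)
    · refine ⟨_, (φ.symm ⟨w, hw⟩ : H).2, ?_⟩
      simpa [ht, hf] using congrArg f (HNNExtension.inv_t_mul_of (φ := φ) ⟨w, hw⟩)
  -- E is the union of both associated subgroups, so avoiding it rules out a pinch whatever the
  -- neighbouring signs.
  refine ⟨⋃ u, ((↑) : H → G) '' (D u), {s | ∃ u v, BrittonProduct H D t u v s}, ?_, ?_, ?_, ?_, ?_,
    fun g hg => ?_⟩
  · refine Set.finite_iUnion fun u => Set.Finite.image _ ?_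
    rcases Int.units_eq_one_or u with rfl | rfl
    exacts [Set.toFinite (A.subgroupOf H : Set H), Set.toFinite (B : Set H)]
  · exact ⟨_, 1, 1, .letter 1⟩
  · rintro s ⟨u, v, hs⟩
    exact ⟨_, _, hs.inv⟩
  · rintro s ⟨u, v, hs⟩ w hw hwE s' ⟨u', v', hs'⟩
    refine ⟨_, _, .mul _ _ _ _ _ ⟨w, hw⟩ _ hs (fun hwD => absurd ?_ hwE) hs'⟩
    exact Set.mem_iUnion.2 ⟨v, _, hwD, rfl⟩
  · rintro s ⟨u, v, hs⟩
    exact hs.notMem f hf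
  -- Stability under (f x)⁻¹ is carried along for the inverse case of the induction.
  · have key : ∀ x : HNNExtension H (A.subgroupOf H) B φ,
        (∀ g : G, (g ∈ H ∨ ∃ a ∈ H, ∃ s, (∃ u v, BrittonProduct H D t u v s) ∧
            ∃ c ∈ H, g = a * s * c) →
          (f x * g ∈ H ∨ ∃ a ∈ H, ∃ s, (∃ u v, BrittonProduct H D t u v s) ∧
            ∃ c ∈ H, f x * g = a * s * c)) ∧
        (∀ g : G, (g ∈ H ∨ ∃ a ∈ H, ∃ s, (∃ u v, BrittonProduct H D t u v s) ∧
            ∃ c ∈ H, g = a * s * c) →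
          ((f x)⁻¹ * g ∈ H ∨ ∃ a ∈ H, ∃ s, (∃ u v, BrittonProduct H D t u v s) ∧
            ∃ c ∈ H, (f x)⁻¹ * g = a * s * c)) := by
      have hleft : ∀ k ∈ H, ∀ g : G,
          (g ∈ H ∨ ∃ a ∈ H, ∃ s, (∃ u v, BrittonProduct H D t u v s) ∧
            ∃ c ∈ H, g = a * s * c) →
          (k * g ∈ H ∨ ∃ a ∈ H, ∃ s, (∃ u v, BrittonProduct H D t u v s) ∧
            ∃ c ∈ H, k * g = a * s * c) := by
        rintro k hk g (hg | ⟨a, ha, s, hs, c, hc, rfl⟩)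
        · exact .inl (H.mul_mem hk hg)
        · exact .inr ⟨k * a, H.mul_mem hk ha, s, hs, c, hc, by simp only [mul_assoc]⟩
      intro x
      induction x using HNNExtension.induction_on with
      | of k =>
        rw [hf]
        exact ⟨hleft _ k.2, hleft _ (H.inv_mem k.2)⟩
      | t =>
        refine ⟨fun g hg => ?_, fun g hg => ?_⟩
        · simpa using BrittonProduct.mul_left_eq hD 1 hg
        · simpa using BrittonProduct.mul_left_eq hD (-1) hg
      | mul x y ihx ihy =>
        refine ⟨fun g hg => ?_, fun g hg => ?_⟩
        · rw [map_mul, mul_assoc]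
          exact ihx.1 _ (ihy.1 _ hg)
        · rw [map_mul, mul_inv_rev, mul_assoc]
          exact ihy.2 _ (ihx.2 _ hg)
      | inv x ih =>
        rw [map_inv, inv_inv]
        exact ih.symm
    have := (key (f.symm g)).1 1 (.inl (one_mem _))
    rw [f.apply_symm_apply, mul_one] at this
    exact this.resolve_left hg

theorem SplitsNontriviallyOver.exists_isFreeConcatenation {G : Type*} [Group G] {A H : Subgroup G}
    (h : SplitsNontriviallyOver A H) (hA : Finite A) :
    ∃ E S : Set G, IsFreeConcatenation H E S := by
  rcases h with ⟨K, hK, i, rfl⟩ | h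
  · exact ⟨_, _, hK.isFreeConcatenation hA i⟩
  · exact h.exists_isFreeConcatenation hA

theorem corollary4 {G : Type*} [Group G] (hG : Group.FG G) (A H : Subgroup G)
    (hA : Finite A) (hsplit : SplitsNontriviallyOver A H) (hH : Infinite H) :
    ∃ X : Subgroup G, IsLargestFiniteNormal X ∧ X ≤ H ∧
      ∃ L : Subgroup G,
        Nonempty (HNNExtension H (X.subgroupOf H) (X.subgroupOf H)
          (MulEquiv.refl (X.subgroupOf H)) ≃* L) := by
  obtain ⟨E, S, hS⟩ := hsplit.exists_isFreeConcatenation hA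
  obtain ⟨ψ, hψ⟩ := hS.exists_injective_hnnExtension
  exact ⟨H.normalCore, hS.isLargestFiniteNormal_normalCore, H.normalCore_le, ψ.range,
    ⟨MonoidHom.ofInjective hψ⟩⟩
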